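/- For a group $G$ and a natural number $n$, let $H^n(G,-)=\operatorname{Ext}^n_{\mathbb{Z}G}(\mathbb{Z},-)$ be the $n$th cohomology functor from $\mathbb{Z}G$-modules to abelian groups, where $\mathbb{Z}$ is the trivial $\mathbb{Z}G$-module. Call $H^n(G,-)$ finitary if it commutes with all (small) filtered colimits of $\mathbb{Z}G$-modules. Let $Q$ be a non-trivial finite group and let $N$ be any group. If there is some natural number $k \ge 0$ such that $H^k(N\times Q,-)$ is finitary, then $N$ is finitely generated. -/

import Mathlib

universe u v

open CategoryTheory Limits

noncomputable section

namespace FinitaryCohomology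

/-- The augmentation `ℤG → ℤ` of the integral group ring, sending every `g : G` to `1`. -/
def augmentation (G : Type u) [Group G] : MonoidAlgebra ℤ G →+* ℤ :=
  (MonoidAlgebra.lift ℤ ℤ G (1 : G →* ℤ)).toRingHom

/-- The abelian group `ℤ` (lifted to the universe of `G`) as a `ℤG`-module with trivial
`G`-action: the module structure is pulled back along the augmentation. -/
def trivialModule (G : Type u) [Group G] : ModuleCat.{u} (MonoidAlgebra ℤ G) :=
  (ModuleCat.restrictScalars (augmentation G)).obj (ModuleCat.of ℤ (ULift.{u} ℤ))

/-- The `n`th cohomology functor `Hⁿ(G, -) = Extⁿ_{ℤG}(ℤ, -)` of a group `G`, from the category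
of `ℤG`-modules to the category of abelian groups. -/
def cohomologyFunctor (G : Type u) [Group G] (n : ℕ) :
    ModuleCat.{u} (MonoidAlgebra ℤ G) ⥤ AddCommGrpCat.{u} :=
  Abelian.extFunctorObj (trivialModule G) n

/-- `Hⁿ(G, -)` is finitary: it commutes with all (small) filtered colimits of coefficient
modules. -/
def IsFinitaryCohomology (G : Type u) [Group G] (n : ℕ) : Prop :=
  PreservesFilteredColimitsOfSize.{u, u} (cohomologyFunctor G n)

end FinitaryCohomology

end

/-! Work stably over `Q`: traces, the maps `∑ q, q ψ(q⁻¹ ·)`, count as zero. By dimension shifting,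
the `k`th syzygy `Ω` of `ℤ` carries a class `x ∈ Extᵏ(ℤ, Ω)` of which every class is a pushforward,
and any map killing `x` is a trace (`exists_universal_class`). Moreover `Ω` is the filtered colimit
of the modules `Ω[N/H]` with `H ≤ N` finitely generated (`isColimitCosetCocone`). Finitariness lifts
`x` to one stage, which yields a linear `g : Ω → Ω[N/H]` whose composite with summation is the
identity up to a trace.

On `ℤ` the group `N` acts trivially, and the identity is not a trace because `|Q| > 1`. Syzygies
inherit this in the form: each `n - 1` is a trace, and the identity is not a trace on some finitely
generated subgroup `W` (`IsAdmissible.ker`). If `N/H` were infinite, the supports of `g(W)` would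
miss a coset. Translating that coset around, every coordinate of `g` on `W` would be a trace, hence
so would the identity on `W` (`IsAdmissible.finite_of_lift`). So `H` has finite index and `N` is
finitely generated. -/

namespace FinitaryCohomology

/-! ### Traces over `Q` -/

section Trace

variable {N : Type*} [Group N] {Q : Type*} [Group Q]

/-- The element `(n, q)` of the integral group ring of `N × Q`. -/
noncomputable def elt (n : N) (q : Q) : MonoidAlgebra ℤ (N × Q) := MonoidAlgebra.of ℤ (N × Q) (n, q)

lemma elt_mul (n n' : N) (q q' : Q) : elt n q * elt n' q' = elt (n * n') (q * q') := by
  simp [elt, MonoidAlgebra.single_mul_single]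

lemma elt_one : elt (1 : N) (1 : Q) = 1 := by
  rw [elt, ← Prod.one_eq_mk, map_one]

variable {A B C : Type*} [AddCommGroup A] [AddCommGroup B] [AddCommGroup C]
  [Module (MonoidAlgebra ℤ (N × Q)) A] [Module (MonoidAlgebra ℤ (N × Q)) B]
  [Module (MonoidAlgebra ℤ (N × Q)) C]

lemma elt_smul_elt_smul (n n' : N) (q q' : Q) (a : A) :
    elt n q • elt n' q' • a = elt (n * n') (q * q') • a := by
  rw [smul_smul, elt_mul]

variable (N Q) in
/-- A subgroup of an `N × Q`-module that is stable under `Q`. -/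
def IsStable (W : AddSubgroup A) : Prop := ∀ (q : Q), ∀ w ∈ W, elt (1 : N) q • w ∈ W

variable (N Q) in
/-- On the subgroup `W`, the map `φ` is the trace over `Q` of an additive map. -/
def IsTraceOn [Fintype Q] (W : AddSubgroup A) (φ : A → B) : Prop :=
  ∃ ψ : A → B, (∀ a ∈ W, ∀ b ∈ W, ψ (a + b) = ψ a + ψ b) ∧
    ∀ w ∈ W, φ w = ∑ q : Q, elt (1 : N) q • ψ (elt (1 : N) q⁻¹ • w)

variable [Fintype Q] {W : AddSubgroup A} {φ φ' : A → B}

lemma IsTraceOn.mono {W' : AddSubgroup A} (h : IsTraceOn N Q W φ) (hW : W' ≤ W) :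
    IsTraceOn N Q W' φ := by
  obtain ⟨ψ, h1, h2⟩ := h
  exact ⟨ψ, fun a ha b hb => h1 a (hW ha) b (hW hb), fun w hw => h2 w (hW hw)⟩

lemma IsTraceOn.congr (h : IsTraceOn N Q W φ) (hφ : ∀ w ∈ W, φ' w = φ w) :
    IsTraceOn N Q W φ' := by
  obtain ⟨ψ, h1, h2⟩ := h
  exact ⟨ψ, h1, fun w hw => (hφ w hw).trans (h2 w hw)⟩

lemma isTraceOn_zero : IsTraceOn N Q W (fun _ => (0 : B)) :=
  ⟨fun _ => 0, by simp, by simp⟩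

lemma IsTraceOn.add (h : IsTraceOn N Q W φ) (h' : IsTraceOn N Q W φ') :
    IsTraceOn N Q W (fun a => φ a + φ' a) := by
  obtain ⟨ψ, h1, h2⟩ := h
  obtain ⟨ψ', h1', h2'⟩ := h'
  refine ⟨fun a => ψ a + ψ' a, fun a ha b hb => ?_, fun w hw => ?_⟩
  · simp only [h1 a ha b hb, h1' a ha b hb]; abel
  · simp only [h2 w hw, h2' w hw, smul_add, Finset.sum_add_distrib]

lemma IsTraceOn.neg (h : IsTraceOn N Q W φ) : IsTraceOn N Q W (fun a => - φ a) := by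
  obtain ⟨ψ, h1, h2⟩ := h
  refine ⟨fun a => - ψ a, fun a ha b hb => ?_, fun w hw => ?_⟩
  · simp only [h1 a ha b hb]; abel
  · simp only [h2 w hw, smul_neg, Finset.sum_neg_distrib]

lemma IsTraceOn.sum {ι : Type*} (s : Finset ι) {φ : ι → A → B}
    (h : ∀ i ∈ s, IsTraceOn N Q W (φ i)) : IsTraceOn N Q W (fun a => ∑ i ∈ s, φ i a) := by
  classical
  induction s using Finset.induction_on with
  | empty => simpa using isTraceOn_zero
  | insert i s hi ih =>
    simp only [Finset.sum_insert hi]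
    exact (h i (by simp)).add (ih fun j hj => h j (by simp [hj]))

/-- Postcomposition of a trace with a `Q`-equivariant map is a trace. -/
lemma IsTraceOn.postcomp (h : IsTraceOn N Q W φ) (f : B →+ C)
    (hf : ∀ (q : Q) b, f (elt (1 : N) q • b) = elt (1 : N) q • f b) :
    IsTraceOn N Q W (fun a => f (φ a)) := by
  obtain ⟨ψ, h1, h2⟩ := h
  refine ⟨fun a => f (ψ a), fun a ha b hb => ?_, fun w hw => ?_⟩
  · simp only [h1 a ha b hb, map_add]
  · simp only [h2 w hw, map_sum, hf]

/-- A map on `W` that factors through a module whose identity is a trace is itself a trace. -/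
lemma IsTraceOn.of_factor (hB : IsTraceOn N Q (⊤ : AddSubgroup B) (id : B → B))
    (f : A → B)
    (hf : ∀ a ∈ W, ∀ b ∈ W, f (a + b) = f a + f b)
    (hfQ : ∀ (q : Q), ∀ a ∈ W, f (elt (1 : N) q • a) = elt (1 : N) q • f a) (g : B →+ C)
    (hg : ∀ (q : Q) b, g (elt (1 : N) q • b) = elt (1 : N) q • g b) :
    IsTraceOn N Q W (fun a => g (f a)) := by
  obtain ⟨τ, h1, h2⟩ := hB
  refine ⟨fun a => g (τ (f a)), fun a ha b hb => ?_, fun w hw => ?_⟩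
  · simp only [hf a ha b hb, h1 _ trivial _ trivial, map_add]
  · have := h2 (f w) trivial
    simp only [id] at this
    refine (congrArg g this).trans ?_
    simp only [map_sum, hg]
    refine Finset.sum_congr rfl fun q _ => ?_
    rw [hfQ _ _ hw]

/-- The identity of a free module is a trace. -/
lemma isTraceOn_id_free (X : Type*) :
    IsTraceOn N Q (⊤ : AddSubgroup (X →₀ MonoidAlgebra ℤ (N × Q))) id := by
  classical
  -- The group ring is the direct sum of the `Q`-translates of `ℤN`; `τ₀` projects onto the summand
  -- `ℤN`.
  let τ₀ : MonoidAlgebra ℤ (N × Q) →+ MonoidAlgebra ℤ (N × Q) :=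
    { toFun := fun f => ⟨f.coeff.filter (fun g => g.2 = 1)⟩
      map_zero' := by rw [MonoidAlgebra.coeff_zero, Finsupp.filter_zero]; rfl
      map_add' := fun f g => by ext; simp [Finsupp.filter_add] }
  have hτ₀ : ∀ f : MonoidAlgebra ℤ (N × Q),
      ∑ q : Q, elt (1 : N) q * τ₀ (elt (1 : N) q⁻¹ * f) = f := by
    intro f
    ext ⟨n, q⟩
    rw [MonoidAlgebra.coeff_sum, Finsupp.finsetSum_apply, Finset.sum_eq_single q]
    · simp [elt, τ₀]
    · intro q' _ hq'
      simp [elt, τ₀, inv_mul_eq_one, hq']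
    · simp
  refine ⟨Finsupp.mapRange.addMonoidHom τ₀, fun a _ b _ => map_add _ a b, fun w _ => ?_⟩
  ext x : 1
  simp [hτ₀]

end Trace
lemma fg_comap_of_injective {A B : Type*} [AddCommGroup A] [AddCommGroup B] {V : AddSubgroup B}
    (hV : V.FG) (f : A →+ B) (hf : Function.Injective f) : (V.comap f).FG := by
  rw [← AddGroup.fg_iff_addSubgroup_fg, ← Module.Finite.iff_addGroup_fg] at hV ⊢
  let g : V.comap f →+ V := f.addSubgroupComap V
  exact Module.Finite.of_injective g.toIntLinearMap fun a b h =>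
    Subtype.ext (hf (congrArg Subtype.val h))

/-! ### Admissible modules and their syzygies -/

section Admissible

variable {N : Type*} [Group N] {Q : Type*} [Group Q] [Fintype Q]

variable (N Q) in
/-- The properties of the trivial module `ℤ` that are inherited by its syzygies: it is projective as
an abelian group, `N` acts trivially up to traces over `Q`, and the identity is not a trace over
`Q` even on some finitely generated subgroup. -/
structure IsAdmissible (A : Type*) [AddCommGroup A] [Module (MonoidAlgebra ℤ (N × Q)) A] :
    Prop where
  projective : Module.Projective ℤ A
  trace_sub (n : N) : IsTraceOn N Q (⊤ : AddSubgroup A) (fun a => elt n (1 : Q) • a - a)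
  exists_fg : ∃ W : AddSubgroup A, W.FG ∧ IsStable N Q W ∧ ¬ IsTraceOn N Q W (id : A → A)

variable {A P : Type*} [AddCommGroup A] [AddCommGroup P]
  [Module (MonoidAlgebra ℤ (N × Q)) A] [Module (MonoidAlgebra ℤ (N × Q)) P]

/-- Lifting the trace `n - 1` from `A` to `P` along the additive section `s` and subtracting it from
`n - 1` on `P` leaves a `Q`-map `P → ker π`. It restricts to `n - 1` on the kernel, which therefore
factors through `P`. -/
lemma isTraceOn_sub_ker (hP : IsTraceOn N Q (⊤ : AddSubgroup P) id)
    (π : P →ₗ[MonoidAlgebra ℤ (N × Q)] A) (s : A →+ P) (hs : ∀ a, π (s a) = a) (n : N)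
    (h : IsTraceOn N Q (⊤ : AddSubgroup A) (fun a => elt n (1 : Q) • a - a)) :
    IsTraceOn N Q (⊤ : AddSubgroup (LinearMap.ker π)) (fun a => elt n (1 : Q) • a - a) := by
  obtain ⟨ψ, h1, h2⟩ := h
  let T : P → P := fun p => elt n (1 : Q) • p - p -
    ∑ q : Q, elt (1 : N) q • s (ψ (elt (1 : N) q⁻¹ • π p))
  have hT : ∀ p, T p ∈ LinearMap.ker π := fun p => by
    simp only [LinearMap.mem_ker, T, map_sub, map_sum, map_smul, hs]
    exact sub_eq_zero.2 (h2 _ trivial)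
  have hψ0 : ψ 0 = 0 := by simpa using h1 0 trivial 0 trivial
  let g : P →+ LinearMap.ker π :=
    { toFun := fun p => ⟨T p, hT p⟩
      map_zero' := by
        ext
        simp [T, hψ0]
      map_add' := fun a b => by
        ext
        simp only [T, smul_add, map_add, h1 _ trivial _ trivial, Finset.sum_add_distrib,
          Submodule.coe_add]
        abel }
  have hg : ∀ (q : Q) p, g (elt (1 : N) q • p) = elt (1 : N) q • g p := by
    intro q p
    ext
    change T (elt (1 : N) q • p) = elt (1 : N) q • T p
    simp only [T, smul_sub, map_smul, Finset.smul_sum, elt_smul_elt_smul, one_mul, mul_one]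
    congr 1
    refine (Fintype.sum_equiv (Equiv.mulLeft q) _ _ fun q' => ?_).symm
    simp [mul_assoc]
  refine (IsTraceOn.of_factor hP (fun a : LinearMap.ker π => (a : P))
    (fun _ _ _ _ => rfl) (fun _ _ _ => rfl) g hg).congr fun w _ => ?_
  ext
  simp [g, T, hψ0]

/-- Take `V ∩ ker π`, where `V` is the `Q`-span of lifts of generators of `W`. If its identity were
a trace, that trace could be extended to `V` and subtracted from the identity, giving a `Q`-map `T`
that kills `V ∩ ker π` and satisfies `π T = π`. Then `T s` would factor the identity of `W` through
`P`. -/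
lemma exists_fg_not_isTraceOn_ker (hP : IsTraceOn N Q (⊤ : AddSubgroup P) id)
    (π : P →ₗ[MonoidAlgebra ℤ (N × Q)] A) (s : A →+ P) (hs : ∀ a, π (s a) = a)
    (h : ∃ W : AddSubgroup A, W.FG ∧ IsStable N Q W ∧ ¬ IsTraceOn N Q W (id : A → A)) :
    ∃ W : AddSubgroup (LinearMap.ker π), W.FG ∧ IsStable N Q W ∧
      ¬ IsTraceOn N Q W (id : LinearMap.ker π → LinearMap.ker π) := by
  obtain ⟨W, ⟨t, ht⟩, hWQ, hW⟩ := h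
  let V : AddSubgroup P :=
    AddSubgroup.closure (Set.range fun x : Q × t => elt (1 : N) x.1 • s (x.2 : A))
  have hV : V.FG := (AddSubgroup.fg_iff _).2 ⟨_, rfl, Set.finite_range _⟩
  have hVQ : IsStable N Q V := by
    intro q p hp
    induction hp using AddSubgroup.closure_induction with
    | mem p hp =>
      obtain ⟨⟨q', x⟩, rfl⟩ := hp
      exact AddSubgroup.subset_closure ⟨⟨q * q', x⟩, by simp [elt_smul_elt_smul]⟩
    | zero => simp
    | add a b _ _ ha hb => simpa using add_mem ha hb
    | neg a _ ha => simpa using ha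
  have hsV : ∀ w ∈ W, s w ∈ V := by
    intro w hw
    rw [← ht] at hw
    induction hw using AddSubgroup.closure_induction with
    | mem x hx =>
      exact AddSubgroup.subset_closure ⟨⟨1, x, hx⟩, by simp [elt_one]⟩
    | zero => simp
    | add a b _ _ ha hb => simpa using add_mem ha hb
    | neg a _ ha => simpa using ha
  have hπV : ∀ p ∈ V, π p ∈ W := by
    intro p hp
    induction hp using AddSubgroup.closure_induction with
    | mem p hp =>
      obtain ⟨⟨q', x⟩, rfl⟩ := hp
      simp only [map_smul, hs]
      exact hWQ _ _ (ht ▸ AddSubgroup.subset_closure x.2)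
    | zero => simp
    | add a b _ _ ha hb => simpa using add_mem ha hb
    | neg a _ ha => simpa using ha
  let i : LinearMap.ker π →+ P := (LinearMap.ker π).subtype.toAddMonoidHom
  refine ⟨V.comap i, fg_comap_of_injective hV i Subtype.val_injective,
    fun q w hw => hVQ q _ hw, fun ⟨ψ, h1, h2⟩ => hW ?_⟩
  let r : P →+ LinearMap.ker π :=
    { toFun := fun p => ⟨p - s (π p), by simp [hs]⟩
      map_zero' := by ext; simp
      map_add' := fun a b => by ext; simp; abel }
  have hrV : ∀ p ∈ V, r p ∈ V.comap i := fun p hp => sub_mem hp (hsV _ (hπV p hp))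
  have hri : ∀ k : LinearMap.ker π, r (k : P) = k := fun k => by ext; simp [r]
  let T : P → P := fun p => p - i (∑ q : Q, elt (1 : N) q • ψ (r (elt (1 : N) q⁻¹ • p)))
  have hT_add : ∀ a ∈ V, ∀ b ∈ V, T (a + b) = T a + T b := by
    intro a ha b hb
    have : ∀ q : Q, ψ (r (elt (1 : N) q⁻¹ • (a + b))) =
        ψ (r (elt (1 : N) q⁻¹ • a)) + ψ (r (elt (1 : N) q⁻¹ • b)) := fun q => by
      rw [smul_add, map_add, h1 _ (hrV _ (hVQ _ _ ha)) _ (hrV _ (hVQ _ _ hb))]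
    simp only [T]
    rw [Finset.sum_congr rfl fun q _ => congrArg (elt (1 : N) q • ·) (this q)]
    simp only [smul_add, Finset.sum_add_distrib, map_add]
    abel
  have hT_smul : ∀ (q : Q) (p : P), T (elt (1 : N) q • p) = elt (1 : N) q • T p := by
    intro q p
    have hi : ∀ k : LinearMap.ker π, elt (1 : N) q • i k = i (elt (1 : N) q • k) := fun _ => rfl
    simp only [T, smul_sub, hi, Finset.smul_sum, elt_smul_elt_smul, one_mul]
    congr 2
    refine (Fintype.sum_equiv (Equiv.mulLeft q) _ _ fun q' => ?_).symm
    refine (elt_smul_elt_smul (1 : N) 1 q q' (ψ (r (elt (1 : N) q'⁻¹ • p)))).trans ?_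
    simp
  have hT_ker : ∀ k ∈ V.comap i, T (k : P) = 0 := by
    intro k hk
    have := h2 k hk
    have hr : ∀ q : Q, r (elt (1 : N) q⁻¹ • (k : P)) = elt (1 : N) q⁻¹ • k := fun q =>
      hri (elt (1 : N) q⁻¹ • k)
    simp only [T, hr, ← this]
    exact sub_self _
  have hπT : ∀ p, π (T p) = π p := by
    intro p
    simp only [T, map_sub]
    exact sub_eq_self.2 (LinearMap.mem_ker.1 (Subtype.property (p := (· ∈ LinearMap.ker π)) _))
  refine (IsTraceOn.of_factor hP (fun w => T (s w)) (fun a ha b hb => ?_)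
    (fun q a ha => ?_) π.toAddMonoidHom (fun q b => π.map_smul _ b)).congr fun w hw => ?_
  · rw [map_add, hT_add _ (hsV a ha) _ (hsV b hb)]
  · rw [← hT_smul]
    -- The failure of `s` to be `Q`-equivariant on `W` lies in `V ∩ ker π`, which `T` kills.
    let k : LinearMap.ker π := ⟨s (elt (1 : N) q • a) - elt (1 : N) q • s a, by simp [hs]⟩
    have hk : k ∈ V.comap i := sub_mem (hsV _ (hWQ q a ha)) (hVQ q _ (hsV a ha))
    have : s (elt (1 : N) q • a) = k + elt (1 : N) q • s a := by simp [k]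
    rw [this, hT_add (k : P) hk _ (hVQ q _ (hsV a ha)), hT_ker k hk, zero_add]
  · simp [hπT, hs]

/-- The kernel of a surjection from a free module onto an admissible module is admissible. -/
lemma IsAdmissible.ker (hA : IsAdmissible N Q A) (hPproj : Module.Projective ℤ P)
    (hP : IsTraceOn N Q (⊤ : AddSubgroup P) id) (π : P →ₗ[MonoidAlgebra ℤ (N × Q)] A)
    (hπ : Function.Surjective π) : IsAdmissible N Q (LinearMap.ker π) := by
  have := hA.projective
  obtain ⟨s, hs⟩ := Module.projective_lifting_property π.toAddMonoidHom.toIntLinearMap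
    LinearMap.id hπ
  have hs' : ∀ a, π (s.toAddMonoidHom a) = a := fun a => LinearMap.congr_fun hs a
  refine ⟨?_, fun n => isTraceOn_sub_ker hP π _ hs' n (hA.trace_sub n),
    exists_fg_not_isTraceOn_ker hP π _ hs' hA.exists_fg⟩
  let i : LinearMap.ker π →+ P := (LinearMap.ker π).subtype.toAddMonoidHom
  let r : P →+ LinearMap.ker π :=
    { toFun := fun p => ⟨p - s (π p), by
        rw [LinearMap.mem_ker, map_sub]
        exact sub_eq_zero.2 (hs' (π p)).symm⟩
      map_zero' := by ext; simp
      map_add' := fun a b => by ext; simp; abel }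
  refine Module.Projective.of_split i.toIntLinearMap r.toIntLinearMap ?_
  ext k
  simp [i, r]

end Admissible

/-! ### Universal classes by dimension shifting -/

section UniversalClass

open Abelian

variable {N : Type u} [Group N] {Q : Type v} [Group Q] [Fintype Q]

/-- The `k`th syzygy `Ω` of an admissible module `X` carries a class `u ∈ Extᵏ(X, Ω)` of which
every other class is an image, and only trace maps kill `u`. -/
lemma exists_universal_class (k : ℕ) (X : ModuleCat.{max u v} (MonoidAlgebra ℤ (N × Q)))
    (hX : IsAdmissible N Q X) :
    ∃ (Ω : ModuleCat.{max u v} (MonoidAlgebra ℤ (N × Q))) (x : Ext X Ω k), IsAdmissible N Q Ω ∧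
      (∀ M (y : Ext X M k), ∃ g : Ω ⟶ M, x.comp (Ext.mk₀ g) (add_zero k) = y) ∧
      ∀ M (g : Ω ⟶ M), x.comp (Ext.mk₀ g) (add_zero k) = 0 →
        IsTraceOn N Q (⊤ : AddSubgroup Ω) g := by
  induction k generalizing X with
  | zero =>
    refine ⟨X, Ext.mk₀ (𝟙 X), hX, fun M y => ?_, fun M g hg => ?_⟩
    · obtain ⟨g, rfl⟩ := Ext.addEquiv₀.symm.surjective y
      exact ⟨g, by simp⟩
    · have : g = 0 := by simpa using hg
      subst this
      exact isTraceOn_zero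
  | succ k ih =>
    let π : (X →₀ MonoidAlgebra ℤ (N × Q)) →ₗ[MonoidAlgebra ℤ (N × Q)] X :=
      Finsupp.linearCombination _ id
    have hπ : Function.Surjective π := Finsupp.linearCombination_id_surjective _ _
    have hS : (LinearMap.shortComplexKer π).ShortExact := LinearMap.shortExact_shortComplexKer hπ
    have hP := isTraceOn_id_free (N := N) (Q := Q) X
    have hproj : Projective (LinearMap.shortComplexKer π).X₂ :=
      ModuleCat.projective_of_categoryTheory_projective _
    obtain ⟨Ω, x, hΩ, h1, h2⟩ := ih (LinearMap.shortComplexKer π).X₁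
      (hX.ker inferInstance hP π hπ)
    refine ⟨Ω, hS.extClass.comp x (add_comm 1 k), hΩ, fun M y => ?_, fun M g hg => ?_⟩
    · obtain ⟨z, rfl⟩ := Ext.contravariant_sequence_exact₃ hS M y (Ext.eq_zero_of_projective _)
        (add_comm 1 k)
      obtain ⟨g, rfl⟩ := h1 M z
      exact ⟨g, Ext.comp_assoc_of_third_deg_zero _ _ _ _⟩
    · rw [Ext.comp_assoc_of_third_deg_zero] at hg
      obtain ⟨z, hz⟩ := Ext.contravariant_sequence_exact₁ hS M _ (add_comm 1 k) hg
      -- In positive degree `Ext` out of the free module vanishes. In degree zero it does not: `g`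
      -- then agrees, up to a trace, with a map factoring through the free module, which is itself a
      -- trace.
      cases k with
      | succ k =>
        rw [Ext.eq_zero_of_projective z, Ext.comp_zero] at hz
        exact h2 M g hz.symm
      | zero =>
        obtain ⟨f, rfl⟩ := Ext.addEquiv₀.symm.surjective z
        obtain ⟨j, hj⟩ := h1 _ (Ext.mk₀ (𝟙 _))
        let i := (LinearMap.shortComplexKer π).f
        have h0 := h2 M (g - j ≫ i ≫ f) (by
          rw [sub_eq_add_neg, Ext.mk₀_add, Ext.mk₀_neg, Ext.comp_add, Ext.comp_neg, ← hz,
            ← Ext.mk₀_comp_mk₀, ← Ext.mk₀_comp_mk₀, ← Ext.comp_assoc_of_third_deg_zero, hj]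
          simp [i])
        have h3 := hP.of_factor (W := (⊤ : AddSubgroup Ω)) (j ≫ i).hom
          (fun a _ b _ => map_add _ a b) (fun q a _ => map_smul _ _ a) f.hom.toAddMonoidHom
          (fun q b => map_smul f.hom _ b)
        exact (h0.add h3).congr fun w _ => by simp

end UniversalClass

/-! ### Finiteness of the coset space -/

section Finite

variable {N : Type*} [Group N] {Q : Type*} [Group Q] [Fintype Q]
  {A : Type*} [AddCommGroup A] [Module (MonoidAlgebra ℤ (N × Q)) A]
  {Y : Type*} [MulAction N Y] [MulAction.IsPretransitive N Y]

/-- If the identity of an admissible module lifts, up to a trace, to an equivariant map into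
finitely supported functions on a transitive `N`-set `Y`, then `Y` is finite. -/
lemma IsAdmissible.finite_of_lift (hA : IsAdmissible N Q A) (g : A →+ (Y →₀ A))
    (hg : ∀ (n : N) (q : Q) (a : A) (y : Y), g (elt n q • a) (n • y) = elt n q • g a y)
    (h : IsTraceOn N Q (⊤ : AddSubgroup A) (fun a => (g a).sum (fun _ b => b) - a)) :
    Finite Y := by
  classical
  by_contra hY
  rw [not_finite_iff_infinite] at hY
  obtain ⟨W, ⟨t, ht⟩, hWQ, hW⟩ := hA.exists_fg
  let T : Finset Y := t.biUnion fun a => (g a).support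
  have hT : ∀ w ∈ W, ∀ y ∉ T, g w y = 0 := by
    intro w hw y hy
    rw [← ht] at hw
    induction hw using AddSubgroup.closure_induction with
    | mem a ha =>
      by_contra hne
      exact hy (Finset.mem_biUnion.2 ⟨a, ha, Finsupp.mem_support_iff.2 hne⟩)
    | zero => simp
    | add a b _ _ ha hb => simp [ha, hb]
    | neg a _ ha => simp [ha]
  obtain ⟨x, hx⟩ := Infinite.exists_notMem_finset T
  have htr : ∀ y, IsTraceOn N Q W (fun a => g a y) := by
    intro y
    obtain ⟨n, rfl⟩ := MulAction.exists_smul_eq N x y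
    -- As `g w` vanishes at `x`, `g (n w)` vanishes at `n • x`. So `g w` at `n • x` equals `-g (n w
    -- - w)` there, and evaluation at a point is `Q`-equivariant because `Q` fixes `Y`.
    have h1 := (((hA.trace_sub n).mono (le_top : W ≤ ⊤)).postcomp
      ((Finsupp.applyAddHom (n • x)).comp g) (fun q b => by
        have := hg 1 q b (n • x)
        rwa [one_smul] at this)).neg
    refine h1.congr fun w hw => ?_
    have h2 := hg n 1 w x
    rw [hT w hw x hx, smul_zero] at h2
    simp [h2]
  have hsum := (IsTraceOn.sum T fun y _ => htr y).add (h.mono (le_top : W ≤ ⊤)).neg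
  refine hW (hsum.congr fun w hw => ?_)
  have : (g w).sum (fun _ b => b) = ∑ y ∈ T, g w y :=
    Finsupp.sum_of_support_subset _ (fun y hy => by
      by_contra hne
      exact Finsupp.mem_support_iff.1 hy (hT w hw y hne)) _ (by simp)
  simp [this]

end Finite

lemma group_fg_of_finite_quotient {N : Type*} [Group N] {S : Set N} (hS : S.Finite)
    [Finite (N ⧸ Subgroup.closure S)] : Group.FG N := by
  let H := Subgroup.closure S
  rw [Group.fg_iff]
  refine ⟨S ∪ Set.range (Quotient.out : N ⧸ H → N), ?_, hS.union (Set.finite_range _)⟩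
  rw [eq_top_iff]
  intro n _
  have h1 : (Quotient.out (n : N ⧸ H))⁻¹ * n ∈ H :=
    QuotientGroup.eq.1 (Quotient.out_eq (n : N ⧸ H))
  have h2 : Quotient.out (n : N ⧸ H) ∈
      Subgroup.closure (S ∪ Set.range (Quotient.out : N ⧸ H → N)) :=
    Subgroup.subset_closure (Or.inr ⟨_, rfl⟩)
  simpa using mul_mem h2 (Subgroup.closure_mono Set.subset_union_left h1)

/-! ### The trivial module is admissible -/

section TrivialModule

variable {N : Type u} [Group N] {Q : Type v} [Group Q] [Fintype Q] [Nontrivial Q]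

omit [Fintype Q] [Nontrivial Q] in
lemma elt_smul_trivialModule (n : N) (q : Q) (a : trivialModule (N × Q)) : elt n q • a = a := by
  have h : augmentation (N × Q) (elt n q) = 1 := by simp [augmentation, elt]
  have h' : elt n q • a = augmentation (N × Q) (elt n q) • (show ULift.{max u v} ℤ from a) := rfl
  rw [h', h, one_smul]

/-- A trace on `ℤ` is multiplication by a multiple of `|Q|`, so the identity is not one. -/
lemma isAdmissible_trivialModule : IsAdmissible N Q (trivialModule (N × Q)) := by
  let e : trivialModule (N × Q) ≃+ ℤ := AddEquiv.ulift
  refine ⟨Module.Projective.of_equiv e.symm.toIntLinearEquiv, fun n => ?_, ⊤, ?_, ?_, ?_⟩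
  · simpa [elt_smul_trivialModule] using isTraceOn_zero
  · rw [← AddGroup.fg_iff_addSubgroup_fg, ← Module.Finite.iff_addGroup_fg]
    exact Module.Finite.equiv
      (e.symm.trans (AddSubgroup.topEquiv (G := trivialModule (N × Q))).symm).toIntLinearEquiv
  · exact fun _ _ _ => trivial
  · rintro ⟨ψ, -, h⟩
    have h1 := congrArg e (h (e.symm 1) trivial)
    simp only [id, elt_smul_trivialModule, AddEquiv.apply_symm_apply, Finset.sum_const, map_nsmul,
      Finset.card_univ] at h1
    have h2 : (Fintype.card Q : ℤ) ∣ 1 := ⟨_, by simpa using h1⟩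
    have h3 : Fintype.card Q = 1 := by
      exact_mod_cast Int.eq_one_of_dvd_one (by positivity) h2
    exact (Fintype.one_lt_card (α := Q)).ne' h3

end TrivialModule

/-! ### Diagonal modules `A[Y]` -/

section Induced

variable {N : Type*} [Group N] {Q : Type*} [Group Q]
  {A : Type*} [AddCommGroup A] [Module (MonoidAlgebra ℤ (N × Q)) A]
  {B : Type*} [AddCommGroup B] [Module (MonoidAlgebra ℤ (N × Q)) B]
  {Y : Type*} [MulAction N Y]

/-- An additive map that commutes with the elements of `N × Q` is linear over the group ring. -/
noncomputable def linearMapOfElt (f : A →+ B)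
    (hf : ∀ (n : N) (q : Q) a, f (elt n q • a) = elt n q • f a) :
    A →ₗ[MonoidAlgebra ℤ (N × Q)] B :=
  MonoidAlgebra.equivariantOfLinearOfComm f.toIntLinearMap fun g a => hf g.1 g.2 a

variable (N Q A Y) in
/-- The diagonal action of `N × Q` on the finitely supported functions from an `N`-set `Y` to an
`N × Q`-module `A`. -/
noncomputable def diagRep : Representation ℤ (N × Q) (Y →₀ A) where
  toFun g := ((Finsupp.liftAddHom fun y : Y => (Finsupp.singleAddHom (g.1 • y)).comp
    (DistribSMul.toAddMonoidHom A (elt g.1 g.2)) : (Y →₀ A) →+ (Y →₀ A))).toIntLinearMap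
  map_one' := by
    ext y a : 2
    simp [elt_one]
  map_mul' g h := by
    ext y a : 2
    simp [elt_smul_elt_smul, mul_smul]

lemma diagRep_single (n : N) (q : Q) (y : Y) (a : A) :
    diagRep N Q A Y (n, q) (Finsupp.single y a) = Finsupp.single (n • y) (elt n q • a) := by
  simp [diagRep]

variable (N Q A Y) in
/-- The finitely supported functions from an `N`-set `Y` to an `N × Q`-module `A`, as a module
with the diagonal action. -/
abbrev DiagModule := (diagRep N Q A Y).asModule

variable (N Q) in
/-- The additive equivalence underlying `DiagModule`. -/
noncomputable def diagEquiv : (Y →₀ A) ≃+ DiagModule N Q A Y :=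
  (diagRep N Q A Y).asModuleEquiv.symm.toAddEquiv

lemma elt_smul_diagEquiv (n : N) (q : Q) (f : Y →₀ A) :
    elt n q • diagEquiv N Q f = diagEquiv N Q (diagRep N Q A Y (n, q) f) :=
  ((diagRep N Q A Y).asModuleEquiv_symm_map_rho (n, q) f).symm

lemma elt_smul_diagEquiv_single (n : N) (q : Q) (y : Y) (a : A) :
    elt n q • diagEquiv N Q (Finsupp.single y a) =
      diagEquiv N Q (Finsupp.single (n • y) (elt n q • a)) := by
  rw [elt_smul_diagEquiv, diagRep_single]

lemma elt_smul_diag_apply (n : N) (q : Q) (f : DiagModule N Q A Y) (y : Y) :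
    (diagEquiv N Q).symm (elt n q • f) (n • y) = elt n q • (diagEquiv N Q).symm f y := by
  obtain ⟨f, rfl⟩ := (diagEquiv N Q).surjective f
  rw [elt_smul_diagEquiv, AddEquiv.symm_apply_apply, AddEquiv.symm_apply_apply]
  induction f using Finsupp.induction_linear with
  | zero => simp
  | add f g hf hg => simp [hf, hg]
  | single x a =>
    classical
    rw [diagRep_single, Finsupp.single_apply, Finsupp.single_apply]
    by_cases h : x = y <;> simp [h]

/-- Linear maps out of `DiagModule` are given on the elements supported at a point. -/
noncomputable def diagLift (f : Y → A →+ B)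
    (hf : ∀ (n : N) (q : Q) y a, f (n • y) (elt n q • a) = elt n q • f y a) :
    DiagModule N Q A Y →ₗ[MonoidAlgebra ℤ (N × Q)] B :=
  linearMapOfElt ((Finsupp.liftAddHom f).comp (diagEquiv N Q).symm.toAddMonoidHom) <| by
    intro n q a
    obtain ⟨a, rfl⟩ := (diagEquiv N Q).surjective a
    induction a using Finsupp.induction_linear with
    | zero => simp
    | add f g hf hg => simp only [map_add, smul_add, hf, hg]
    | single x a =>
      rw [elt_smul_diagEquiv_single]
      simp [hf]

lemma diagLift_single (f : Y → A →+ B)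
    (hf : ∀ (n : N) (q : Q) y a, f (n • y) (elt n q • a) = elt n q • f y a) (y : Y) (a : A) :
    diagLift f hf (diagEquiv N Q (Finsupp.single y a)) = f y a := by
  change Finsupp.liftAddHom f ((diagEquiv N Q).symm (diagEquiv N Q (Finsupp.single y a))) = _
  simp

lemma diag_hom_ext {f g : DiagModule N Q A Y →ₗ[MonoidAlgebra ℤ (N × Q)] B}
    (h : ∀ y a, f (diagEquiv N Q (Finsupp.single y a)) = g (diagEquiv N Q (Finsupp.single y a))) :
    f = g := by
  ext a
  obtain ⟨a, rfl⟩ := (diagEquiv N Q).surjective a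
  induction a using Finsupp.induction_linear with
  | zero => simp
  | add a b ha hb => simp only [map_add, ha, hb]
  | single x a => exact h x a

variable (Q A) in
/-- The map of diagonal modules induced by a map of `N`-sets. -/
noncomputable def diagMap {Y' : Type*} [MulAction N Y'] (f : Y →[N] Y') :
    DiagModule N Q A Y →ₗ[MonoidAlgebra ℤ (N × Q)] DiagModule N Q A Y' :=
  diagLift (fun y => (diagEquiv N Q).toAddMonoidHom.comp (Finsupp.singleAddHom (f y)))
    fun n q y a => by simp [elt_smul_diagEquiv_single]

lemma diagMap_single {Y' : Type*} [MulAction N Y'] (f : Y →[N] Y') (y : Y) (a : A) :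
    diagMap Q A f (diagEquiv N Q (Finsupp.single y a)) = diagEquiv N Q (Finsupp.single (f y) a) :=
  diagLift_single _ _ _ _

variable (N Q A Y) in
/-- The sum of the values of a finitely supported function. -/
noncomputable def diagSum : DiagModule N Q A Y →ₗ[MonoidAlgebra ℤ (N × Q)] A :=
  diagLift (fun _ => AddMonoidHom.id A) fun _ _ _ _ => rfl

lemma diagSum_single (y : Y) (a : A) :
    diagSum N Q A Y (diagEquiv N Q (Finsupp.single y a)) = a :=
  diagLift_single _ _ _ _

end Induced

/-! ### `Ω` as a filtered colimit over finitely generated subgroups -/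

section Colimit

variable {N : Type u} [Group N] {Q : Type v}

/-- The subgroup of `N` generated by the first coordinates of `S`. -/
def fstClosure (S : Finset (N × Q)) : Subgroup N := Subgroup.closure (Prod.fst '' (S : Set (N × Q)))

lemma fstClosure_mono {S T : Finset (N × Q)} (h : S ≤ T) : fstClosure S ≤ fstClosure T :=
  Subgroup.closure_mono (Set.image_mono h)

/-- The projection of coset spaces, as a map of `N`-sets. -/
def cosetMap {S T : Finset (N × Q)} (h : S ≤ T) : N ⧸ fstClosure S →[N] N ⧸ fstClosure T where
  toFun := Subgroup.quotientMapOfLE (fstClosure_mono h)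
  map_smul' n y := by
    induction y using QuotientGroup.induction_on
    rfl

variable [Group Q] (Ω : ModuleCat.{max u v} (MonoidAlgebra ℤ (N × Q)))

/-- The filtered system of the modules of finitely supported functions on `N ⧸ H` with values in
`Ω`, where `H` runs through the finitely generated subgroups of `N`. -/
noncomputable def cosetSystem : Finset (N × Q) ⥤ ModuleCat.{max u v} (MonoidAlgebra ℤ (N × Q)) where
  obj S := ModuleCat.of _ (DiagModule N Q Ω (N ⧸ fstClosure S))
  map f := ModuleCat.ofHom (diagMap Q Ω (cosetMap f.le))
  map_id S := by
    refine ModuleCat.hom_ext (diag_hom_ext fun y a => ?_)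
    induction y using QuotientGroup.induction_on
    exact diagMap_single _ _ _
  map_comp f g := by
    refine ModuleCat.hom_ext (diag_hom_ext fun y a => ?_)
    induction y using QuotientGroup.induction_on
    simp only [ModuleCat.hom_ofHom, ModuleCat.hom_comp, LinearMap.comp_apply, diagMap_single]
    rfl

/-- The cocone on `cosetSystem` given by summation. -/
noncomputable def cosetCocone : Cocone (cosetSystem Ω) where
  pt := Ω
  ι :=
    { app := fun S => ModuleCat.ofHom (diagSum N Q Ω (N ⧸ fstClosure S))
      naturality := fun S T f => by
        refine ModuleCat.hom_ext (diag_hom_ext fun y a => ?_)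
        simp [cosetSystem, diagMap_single, diagSum_single] }

-- Adjoining `(n, 1)` to `S` puts `n` in the subgroup, so every coset is eventually identified with
-- the trivial one.
variable {Ω} in
lemma cocone_single (s : Cocone (cosetSystem Ω)) (S : Finset (N × Q)) (n : N) (a : Ω) :
    (s.ι.app S).hom (diagEquiv N Q (Finsupp.single (n : N ⧸ fstClosure S) a)) =
      (s.ι.app ∅).hom
        (diagEquiv N Q (Finsupp.single ((1 : N) : N ⧸ fstClosure (∅ : Finset (N × Q))) a)) := by
  classical
  have key : ∀ {S T : Finset (N × Q)} (h : S ≤ T) (n : N),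
      (s.ι.app S).hom (diagEquiv N Q (Finsupp.single (n : N ⧸ fstClosure S) a)) =
      (s.ι.app T).hom (diagEquiv N Q (Finsupp.single (n : N ⧸ fstClosure T) a)) := by
    intro S T h n
    rw [← s.w (homOfLE h)]
    exact congrArg (s.ι.app T).hom (diagMap_single (cosetMap h) (n : N ⧸ fstClosure S) a)
  rw [key (Finset.subset_insert (n, 1) S) n, key (Finset.empty_subset (insert (n, (1 : Q)) S)) 1]
  congr 3
  have hn : n ∈ fstClosure (insert (n, (1 : Q)) S) :=
    Subgroup.subset_closure ⟨(n, (1 : Q)), by simp, rfl⟩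
  exact (QuotientGroup.eq.2 (by simpa using hn)).symm

/-- The module `Ω` is the colimit of `cosetSystem Ω`. -/
noncomputable def isColimitCosetCocone : IsColimit (cosetCocone Ω) where
  desc s := ModuleCat.ofHom <| linearMapOfElt
    ((s.ι.app ∅).hom.toAddMonoidHom.comp <| (diagEquiv N Q).toAddMonoidHom.comp <|
      Finsupp.singleAddHom ((1 : N) : N ⧸ fstClosure (∅ : Finset (N × Q)))) <| by
    intro n q a
    change (s.ι.app ∅).hom (diagEquiv N Q (Finsupp.single _ (elt n q • a))) =
      elt n q • (s.ι.app ∅).hom (diagEquiv N Q (Finsupp.single _ a))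
    refine Eq.trans ?_ ((s.ι.app ∅).hom.map_smul (elt n q) (diagEquiv N Q (Finsupp.single _ a)))
    refine (cocone_single s ∅ n _).symm.trans (congrArg _ (Eq.trans ?_ (elt_smul_diagEquiv_single n q _ a).symm))
    congr 2
    exact congrArg QuotientGroup.mk (mul_one n).symm
  fac s S := by
    refine ModuleCat.hom_ext (diag_hom_ext fun y a => ?_)
    induction y using QuotientGroup.induction_on with | _ n
    refine Eq.trans ?_ (cocone_single s S n a).symm
    exact congrArg (fun a => (s.ι.app ∅).hom (diagEquiv N Q (Finsupp.single _ a)))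
      (diagSum_single (Q := Q) (n : N ⧸ fstClosure S) a)
  uniq s m hm := by
    ext a
    refine Eq.trans ?_ (congrArg (fun f => f.hom (diagEquiv N Q (Finsupp.single
      ((1 : N) : N ⧸ fstClosure (∅ : Finset (N × Q))) a))) (hm ∅))
    exact congrArg m.hom (diagSum_single _ _).symm

end Colimit

end FinitaryCohomology

open FinitaryCohomology in
theorem proposition2p4 (N : Type u) [Group N] (Q : Type v) [Group Q] [Finite Q] [Nontrivial Q]
    (k : ℕ) (h : FinitaryCohomology.IsFinitaryCohomology (N × Q) k) :
    Group.FG N := by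
  have := Fintype.ofFinite Q
  obtain ⟨Ω, x, hΩ, h1, h2⟩ := exists_universal_class k (trivialModule (N × Q))
    isAdmissible_trivialModule
  -- Finite subsets of `N × Q`, rather than of `N`, put the index category in the universe `max u v`
  -- of the coefficients.
  have hF := h.preserves_filtered_colimits (Finset (N × Q))
  obtain ⟨S, y, hy⟩ := Concrete.isColimit_exists_rep _
    (isColimitOfPreserves (cohomologyFunctor (N × Q) k) (isColimitCosetCocone Ω)) x
  obtain ⟨g, rfl⟩ := h1 _ y
  let σ : (cosetSystem Ω).obj S ⟶ Ω := (cosetCocone Ω).ι.app S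
  have h3 : (x.comp (Abelian.Ext.mk₀ g) (add_zero k)).comp (Abelian.Ext.mk₀ σ) (add_zero k) = x :=
    hy
  have h4 := h2 Ω (g ≫ σ - 𝟙 Ω) (by
    rw [Abelian.Ext.comp_assoc_of_third_deg_zero, Abelian.Ext.mk₀_comp_mk₀] at h3
    rw [sub_eq_add_neg, Abelian.Ext.mk₀_add, Abelian.Ext.mk₀_neg, Abelian.Ext.comp_add,
      Abelian.Ext.comp_neg, h3, Abelian.Ext.comp_mk₀_id, add_neg_cancel])
  let f : Ω →+ (N ⧸ fstClosure S →₀ Ω) :=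
    (diagEquiv N Q).symm.toAddMonoidHom.comp g.hom.toAddMonoidHom
  have : Finite (N ⧸ Subgroup.closure (Prod.fst '' (S : Set (N × Q)))) :=
    hΩ.finite_of_lift f (fun n q a y => by
      refine Eq.trans ?_ (elt_smul_diag_apply n q (g.hom a) y)
      exact congrArg (fun b => (diagEquiv N Q).symm b (n • y)) (g.hom.map_smul _ a))
      (h4.congr fun w _ => rfl)
  exact group_fg_of_finite_quotient (S.finite_toSet.image Prod.fst)
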